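/- **Setting.** Let $\mathbb{R}^n=\mathbb{R}^{n_1}\times\dots\times\mathbb{R}^{n_N}$, let $f_i:\mathbb{R}^{n_i}\to\mathbb{R}\cup\{+\infty\}$ ($i=1,\dots,N$) be closed proper convex functions and let $h:\mathbb{R}^n\to\mathbb{R}\cup\{+\infty\}$ be proper convex. The problem $\min_x h(x)+\sum_i f_i(x_i)$ has the dual $$\min_{\lambda\in\mathbb{R}^n}\ H(\lambda)+F(\lambda),\qquad H(\lambda)=h^\star(-\lambda),\quad F(\lambda)=\sum_{i=1}^N f_i^\star(\lambda_i),$$ and it is assumed that $0\in\partial H(\bar\lambda)+\partial F(\bar\lambda)$ for some $\bar\lambda$. Let $\rho>0$, $\gamma=1/\rho$, $\eta^k\in(0,2)$ for $k\ge 0$, and let $f_i^\gamma(z)=\min_x\{f_i(x)+\frac{1}{2\gamma}\|x-z\|^2\}$ be the Moreau envelope of $f_i$. For $v,z\in\mathbb{R}^{n_i}$ put $$\hat{\mathcal G}_i(v;z)=\{g\in\mathbb{R}^{n_i}:\ \gamma\|g-\nabla f_i^\gamma(z)\|^2-\langle g-\nabla f_i^\gamma(z),v-z\rangle\le 0\}.$$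 **Algorithm 1.** Start from arbitrary $x^0,y^0,\lambda^0\in\mathbb{R}^n$, with $s^0=\|x^0-y^0\|$ and no query points. Iteration $k=0,1,2,\dots$: 1. $x^{k+1}\in\operatorname{argmin}_x\{h(x)+\frac{\rho}{2}\|x-y^k+\frac1\rho\lambda^k\|^2\}$, $\ \tilde x^{k+1}=\eta^kx^{k+1}+(1-\eta^k)y^k$, $\ v^k=\tilde x^{k+1}+\frac1\rho\lambda^k$. 2. For every agent $i$ choose an estimate $g_i^k$ of $\nabla f_i^\gamma(v_i^k)$. If agent $i$ has query points $z_{i,j}$, $j\in\mathcal J$, $\mathcal J\neq\emptyset$, pick $j^*\in\operatorname{argmax}_{j\in\mathcal J}\{f_i^\gamma(z_{i,j})+\langle\nabla f_i^\gamma(z_{i,j}),v_i^k-z_{i,j}\rangle\}$ and let $g_i^k$ be the minimizer of $\|g-\nabla f_i^\gamma(z_{i,j^*})\|$ over $g\in\bigcap_{j\in\mathcal J}\hat{\mathcal G}_i(v_i^k;z_{i,j})$; if there is no query point yet, $g_i^k$ is arbitrary. 3. $\hat y^{k+1}=v^k-\frac1\rho g^k$ and $s^{k+1}=\|x^{k+1}-\hat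 y^{k+1}\|$. 4. If $s^k-s^{k+1}<0$, there is a communication round: every agent computes $y_i^{k+1}=\operatorname{argmin}_{u}\{f_i(u)+\frac\rho2\|u-v_i^k\|^2\}$, and $v_i^k$ becomes a query point of agent $i$. Otherwise $y^{k+1}=\hat y^{k+1}$. 5. $\lambda^{k+1}=\lambda^k+\rho(\tilde x^{k+1}-y^{k+1})$. The error of iteration $k$ is $e^k=g^k-(\nabla f_1^\gamma(v_1^k),\dots,\nabla f_N^\gamma(v_N^k))$ if there is no communication round in iteration $k$, and $e^k=0$ if there is one (the agents then supply the exact gradients). **Theorem.** Suppose that $\sum_k\eta^{k+1}\|e^k\|<\infty$ and $\sum_k\eta^k(2-\eta^k)=\infty$. Then for every sequence generated by Algorithm 1 there is an optimizer $\lambda^*$ of the dual problem such that $\lambda^{k+1}-e^k\to\lambda^*$. The multiplier sequence $\lambda^k$ itself converges to $\lambda^*$ if and only if $e^k\to0$; in particular $\lambda^k\to\lambda^*$ whenever communication rounds occur infinitely often. -/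

import Mathlib

open Set Filter Topology
open scoped RealInnerProductSpace

noncomputable section

namespace ProxEstimation

section Convex

variable {E : Type*} [NormedAddCommGroup E] [InnerProductSpace ℝ E]

/-- Properness of an extended-real-valued function: it never takes the value `-∞` and it is
not identically `+∞`. -/
def IsProper (f : E → EReal) : Prop :=
  (∀ x, f x ≠ ⊥) ∧ ∃ x, f x ≠ ⊤

/-- The epigraph of `f`, a subset of `E × ℝ`. -/
def epi (f : E → EReal) : Set (E × ℝ) :=
  {p | f p.1 ≤ (p.2 : EReal)}

/-- Proper convex functions with values in `ℝ ∪ {+∞}`. -/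
def IsProperConvex (f : E → EReal) : Prop :=
  IsProper f ∧ Convex ℝ (epi f)

/-- Closed (that is, lower semicontinuous) proper convex functions. -/
def IsClosedProperConvex (f : E → EReal) : Prop :=
  IsProperConvex f ∧ LowerSemicontinuous f

/-- The convex conjugate `f⋆(l) = sup_x (⟨x, l⟩ - f x)`. -/
def conj (f : E → EReal) (l : E) : EReal :=
  ⨆ x : E, (((⟪x, l⟫ : ℝ) : EReal) - f x)

/-- The subdifferential of `f` at `x` (empty outside the effective domain). -/
def subdiff (f : E → EReal) (x : E) : Set E :=
  {u | f x ≠ ⊤ ∧ ∀ z, f x + ((⟪u, z - x⟫ : ℝ) : EReal) ≤ f z}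

/-- `p` minimizes `u ↦ f u + (ρ / 2) ‖u - w‖ ^ 2` over the whole space; that is,
`p` is the proximal point of `(1 / ρ) f` at `w`. -/
def IsProxPoint (ρ : ℝ) (f : E → EReal) (w p : E) : Prop :=
  IsMinOn (fun u : E => f u + ((ρ / 2 * ‖u - w‖ ^ 2 : ℝ) : EReal)) univ p

/-- The Moreau envelope `f^γ(z) = min_x (f x + ‖x - z‖ ^ 2 / (2 γ))`; it is finite everywhere
when `f` is closed proper convex and `γ > 0`. -/
def moreauEnv (γ : ℝ) (f : E → EReal) (z : E) : ℝ :=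
  (⨅ x : E, (f x + ((1 / (2 * γ) * ‖x - z‖ ^ 2 : ℝ) : EReal))).toReal

variable [CompleteSpace E]

/-- The gradient of the Moreau envelope. -/
def envGrad (γ : ℝ) (f : E → EReal) (z : E) : E :=
  gradient (moreauEnv γ f) z

/-- The ball of candidates for the gradient of the envelope at `v` that the co-coercivity
inequality with the query point `z` allows. -/
def gradSet (γ : ℝ) (f : E → EReal) (v z : E) : Set E :=
  {g | γ * ‖g - envGrad γ f z‖ ^ 2 - ⟪g - envGrad γ f z, v - z⟫ ≤ 0}

/-- `g` is an estimate of the gradient of the envelope at `v` from the query points `q j`,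
`j ∈ J`: for some index `jmax` whose affine minorant of the envelope is largest at `v`, the vector
`g` is the point of the intersection of the sets `gradSet γ f v (q j)` that is nearest to the
gradient at `q jmax`. -/
def IsEstimate (γ : ℝ) (f : E → EReal) (J : Set ℕ) (q : ℕ → E) (v g : E) : Prop :=
  ∃ jmax ∈ J,
    (∀ j ∈ J, moreauEnv γ f (q j) + ⟪envGrad γ f (q j), v - q j⟫
      ≤ moreauEnv γ f (q jmax) + ⟪envGrad γ f (q jmax), v - q jmax⟫) ∧
    (∀ j ∈ J, g ∈ gradSet γ f v (q j)) ∧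
    ∀ g' : E, (∀ j ∈ J, g' ∈ gradSet γ f v (q j)) →
      ‖g - envGrad γ f (q jmax)‖ ≤ ‖g' - envGrad γ f (q jmax)‖

end Convex

/-- The Euclidean space of dimension `n 0 + ⋯ + n (N - 1)`, split into the blocks of the agents. -/
abbrev Block {N : ℕ} (n : Fin N → ℕ) : Type :=
  PiLp 2 (fun i : Fin N => EuclideanSpace ℝ (Fin (n i)))

section Dual

variable {N : ℕ} {n : Fin N → ℕ}

/-- `H(l) = h⋆(-l)`. -/
def dualH (h : Block n → EReal) (l : Block n) : EReal :=
  conj h (-l)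

/-- `F(l) = ∑ i, f_i⋆(l_i)`. -/
def dualF (f : ∀ i : Fin N, EuclideanSpace ℝ (Fin (n i)) → EReal) (l : Block n) : EReal :=
  ∑ i, conj (f i) (l i)

/-- `l` is an optimizer of the dual problem: minimize `H + F`. -/
def IsDualOptimizer (h : Block n → EReal)
    (f : ∀ i : Fin N, EuclideanSpace ℝ (Fin (n i)) → EReal) (l : Block n) : Prop :=
  IsMinOn (fun m : Block n => dualH h m + dualF f m) univ l

end Dual

/-- The sequences that the algorithm produces: coordinator variable `x`, agents' variable `y`,
multiplier `lam` and gradient estimates `g` (the first three indexed as iterates, and `g k`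
computed in iteration `k`). The values `y (k + 1)` and `lam (k + 1)` are those at the end of
iteration `k`, after the communication, if there is one. -/
structure Trajectory {N : ℕ} (n : Fin N → ℕ) where
  x : ℕ → Block n
  y : ℕ → Block n
  lam : ℕ → Block n
  g : ℕ → Block n

namespace Trajectory

variable {N : ℕ} {n : Fin N → ℕ} (t : Trajectory n) (ρ : ℝ) (η : ℕ → ℝ)

/-- The relaxed iterate `η^k x^{k+1} + (1 - η^k) y^k` of iteration `k`. -/
def xt (k : ℕ) : Block n :=
  η k • t.x (k + 1) + (1 - η k) • t.y k

/-- The point `v^k` at which the agents' proximal problems are posed in iteration `k`. -/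
def v (k : ℕ) : Block n :=
  t.xt η k + (1 / ρ) • t.lam k

/-- The guess of `y^{k+1}` that the coordinator makes from the gradient estimate. -/
def yGuess (k : ℕ) : Block n :=
  t.v ρ η k - (1 / ρ) • t.g k

/-- The residual `s^k` on which the communication test is based; `s^{k+1}` is computed from
`x^{k+1}` and the guess of `y^{k+1}`. -/
def s : ℕ → ℝ
  | 0 => ‖t.x 0 - t.y 0‖
  | k + 1 => ‖t.x (k + 1) - t.yGuess ρ η k‖

/-- The test that triggers a communication round in iteration `k`. -/
def Communicates (k : ℕ) : Prop :=
  t.s ρ η k - t.s ρ η (k + 1) < 0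

/-- The earlier communication rounds; the query points of agent `i` known in iteration `k` are
`v^j_i` for `j` in this set. -/
def queries (k : ℕ) : Set ℕ :=
  {j | j < k ∧ t.Communicates ρ η j}

open Classical in
/-- The error `e^k` of iteration `k`: estimated gradient minus true gradient of the envelopes
(with `γ = 1 / ρ`), and zero if the agents communicated, since they then supply the true one. -/
def err (f : ∀ i : Fin N, EuclideanSpace ℝ (Fin (n i)) → EReal) (k : ℕ) : Block n :=
  if t.Communicates ρ η k then 0
  else t.g k - WithLp.toLp 2 (fun i => envGrad (1 / ρ) (f i) (t.v ρ η k i))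

/-- The trajectory is generated by the algorithm (with an infinite number of iterations). While
there is no query point yet, the gradient estimate is unrestricted. -/
structure IsGenerated (h : Block n → EReal)
    (f : ∀ i : Fin N, EuclideanSpace ℝ (Fin (n i)) → EReal) : Prop where
  x_update : ∀ k, IsProxPoint ρ h (t.y k - (1 / ρ) • t.lam k) (t.x (k + 1))
  estimate : ∀ k, (t.queries ρ η k).Nonempty → ∀ i,
    IsEstimate (1 / ρ) (f i) (t.queries ρ η k) (fun j => t.v ρ η j i) (t.v ρ η k i) (t.g k i)
  y_guessed : ∀ k, ¬ t.Communicates ρ η k → t.y (k + 1) = t.yGuess ρ η k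
  y_communicated : ∀ k, t.Communicates ρ η k → ∀ i,
    IsProxPoint ρ (f i) (t.v ρ η k i) (t.y (k + 1) i)
  lam_update : ∀ k, t.lam (k + 1) = t.lam k + ρ • (t.xt η k - t.y (k + 1))

end Trajectory

end ProxEstimation

end

/-! Put `w k = ρ v^k`, and let `A` and `B` be the resolvents of `∂H` and `∂F` with parameter `ρ`. By
the envelope formula `∇f^γ(z) = ρ (z - prox z)`, the exact gradients at `v^k` form `B (w k)`. Hence
`λ^{k+1} = B (w k) + e^k`, and eliminating `x` and `y` gives the relaxed Douglas-Rachford step `w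
(k+1) = w k + η^{k+1} (A (2 λ^{k+1} - w k) - λ^{k+1})` (`v_succ`).

The error enters `A` as `2 e^k` and is subtracted once outside. Since `2 A - 1` is nonexpansive, the
total perturbation has norm at most `‖e^k‖` (`norm_reflect_le`). The Krasnoselskii-Mann theorem with
summable errors (`FirmlyNonexpansive.exists_tendsto`) then gives `w k → z` with `A (2 B z - z) = B
z`. By continuity `λ^{k+1} - e^k = B (w k) → B z`, and the fixed-point equation is Fermat's rule for
`H + F` at `B z`. The equivalence with `e^k → 0` follows at once.

If communication recurs forever, each estimate lies in the ball attached to a late query point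
`v^j`, so `‖e^k‖ ≤ 3 ρ ‖v^k - v^j‖` (`norm_err_le`), which is small because `v` is Cauchy. -/

noncomputable section

namespace ProxEstimation

/-! ### Firmly nonexpansive maps and inexact fixed-point iterations. -/

section KrasnoselskiiMann

variable {E : Type*} [NormedAddCommGroup E] [InnerProductSpace ℝ E]

/-- Firmly nonexpansive maps. -/
def FirmlyNonexpansive (T : E → E) : Prop :=
  ∀ x y, ‖T x - T y‖ ^ 2 ≤ ⟪T x - T y, x - y⟫

theorem FirmlyNonexpansive.norm_sub_le {T : E → E} (hT : FirmlyNonexpansive T) (x y : E) :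
    ‖T x - T y‖ ≤ ‖x - y‖ := by
  have h1 := (hT x y).trans (real_inner_le_norm _ _)
  by_contra! h2
  nlinarith [norm_nonneg (x - y), norm_nonneg (T x - T y)]

theorem FirmlyNonexpansive.continuous {T : E → E} (hT : FirmlyNonexpansive T) :
    Continuous T :=
  (LipschitzWith.of_dist_le_mul (K := 1) fun x y => by
    simpa [dist_eq_norm] using hT.norm_sub_le x y).continuous

/-- The reflection `2 T - 1` of a firmly nonexpansive map is nonexpansive. -/
theorem FirmlyNonexpansive.norm_reflect_le {T : E → E} (hT : FirmlyNonexpansive T) (x e : E) :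
    ‖T (x + (2 : ℝ) • e) - T x - e‖ ≤ ‖e‖ := by
  have h1 := hT (x + (2 : ℝ) • e) x
  rw [add_sub_cancel_left, inner_smul_right] at h1
  -- With `d` the increment of `T`, `h1` reads `‖d‖² ≤ 2⟪d, e⟫`; completing the square gives `‖d -
  -- e‖² ≤ ‖e‖²`.
  have h2 := norm_sub_sq_real (T (x + (2 : ℝ) • e) - T x) e
  exact le_of_sq_le_sq (by linarith) (norm_nonneg _)

/-- The Douglas-Rachford operator is firmly nonexpansive. -/
theorem FirmlyNonexpansive.douglasRachford {A B : E → E} (hA : FirmlyNonexpansive A)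
    (hB : FirmlyNonexpansive B) :
    FirmlyNonexpansive fun w => w + (A ((2 : ℝ) • B w - w) - B w) := by
  intro x y
  have h1 := hA ((2 : ℝ) • B x - x) ((2 : ℝ) • B y - y)
  have h2 := hB x y
  set a := A ((2 : ℝ) • B x - x) - A ((2 : ℝ) • B y - y)
  have e1 : (2 : ℝ) • B x - x - ((2 : ℝ) • B y - y) = (2 : ℝ) • (B x - B y) - (x - y) := by
    module
  have e2 : x + (A ((2 : ℝ) • B x - x) - B x) - (y + (A ((2 : ℝ) • B y - y) - B y))
      = (x - y) + a - (B x - B y) := by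
    simp only [a]; abel
  simp only [e2]
  rw [e1] at h1
  -- In terms of `a`, `b`, `d` the goal is exactly the sum of `h1` and `h2`.
  generalize B x - B y = b at *
  generalize x - y = d at *
  clear_value a
  simp only [← real_inner_self_eq_norm_sq, inner_add_left, inner_sub_left, inner_add_right,
    inner_sub_right, inner_smul_right] at *
  linarith [real_inner_comm a b, real_inner_comm a d, real_inner_comm b d]

/-- One exact relaxed step of a firmly nonexpansive map. -/
theorem FirmlyNonexpansive.norm_relax_sq_le {T : E → E} (hT : FirmlyNonexpansive T) {z : E}
    (hz : T z = z) (w : E) {r : ℝ} (hr : 0 ≤ r) :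
    ‖w + r • (T w - w) - z‖ ^ 2 ≤ ‖w - z‖ ^ 2 - r * (2 - r) * ‖T w - w‖ ^ 2 := by
  have h1 := hT w z
  rw [hz] at h1
  have e1 : w + r • (T w - w) - z = (w - z) + r • (T w - w) := by abel
  have e2 : T w - z = (w - z) + (T w - w) := by abel
  rw [e1]
  rw [e2] at h1
  generalize T w - w = d at *
  generalize w - z = a at *
  simp only [← real_inner_self_eq_norm_sq, inner_add_left, inner_add_right,
    inner_smul_right, inner_smul_left, conj_trivial] at *
  have h2 : ⟪a, d⟫ ≤ -⟪d, d⟫ := by linarith [real_inner_comm a d]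
  have h3 := mul_le_mul_of_nonneg_left h2 hr
  nlinarith [real_inner_comm a d]

/-- A nonnegative sequence with summable increments converges to zero as soon as a subsequence
does. -/
theorem tendsto_zero_of_le_add_summable {a b : ℕ → ℝ} (ha : ∀ k, 0 ≤ a k) (hb : ∀ k, 0 ≤ b k)
    (hs : Summable b) (hab : ∀ k, a (k + 1) ≤ a k + b k) {φ : ℕ → ℕ} (hφ : StrictMono φ)
    (h0 : Tendsto (a ∘ φ) atTop (𝓝 0)) : Tendsto a atTop (𝓝 0) := by
  -- Subtracting the partial sums of `b` leaves a monotone bounded sequence, so `a` converges; the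
  -- subsequence identifies its limit.
  have hanti : Antitone fun k => a k - ∑ i ∈ Finset.range k, b i :=
    antitone_nat_of_succ_le fun k => by
      rw [Finset.sum_range_succ]; linarith [hab k]
  have hbdd : BddBelow (range fun k => a k - ∑ i ∈ Finset.range k, b i) := by
    refine ⟨-∑' i, b i, ?_⟩
    rintro _ ⟨k, rfl⟩
    have := hs.sum_le_tsum (Finset.range k) fun i _ => hb i
    simp only
    linarith [ha k]
  have hlim := (tendsto_atTop_ciInf hanti hbdd).add hs.hasSum.tendsto_sum_nat
  simp only [sub_add_cancel] at hlim
  have := tendsto_nhds_unique (hlim.comp hφ.tendsto_atTop) h0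
  rwa [this] at hlim

/-- The Krasnoselskii-Mann iteration with summable errors. -/
theorem FirmlyNonexpansive.exists_tendsto [FiniteDimensional ℝ E] {T : E → E}
    (hT : FirmlyNonexpansive T) (hfix : ∃ z, T z = z) {r : ℕ → ℝ}
    (hr : ∀ k, r k ∈ Ioo (0 : ℝ) 2) {w ε : ℕ → E}
    (hw : ∀ k, w (k + 1) = w k + r k • (T (w k) - w k + ε k))
    (hsum : Summable fun k => r k * ‖ε k‖)
    (hdiv : Tendsto (fun K => ∑ k ∈ Finset.range K, r k * (2 - r k)) atTop atTop) :
    ∃ z, T z = z ∧ Tendsto w atTop (𝓝 z) := by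
  have hr0 : ∀ k, 0 ≤ r k := fun k => (hr k).1.le
  have hb : ∀ k, 0 ≤ r k * ‖ε k‖ := fun k => mul_nonneg (hr0 k) (norm_nonneg _)
  have hc : ∀ k, 0 ≤ r k * (2 - r k) := fun k => mul_nonneg (hr0 k) (by linarith [(hr k).2])
  have hstep : ∀ z k, ‖w (k + 1) - z‖ ≤ ‖w k + r k • (T (w k) - w k) - z‖ + r k * ‖ε k‖ := by
    intro z k
    have : w (k + 1) - z = (w k + r k • (T (w k) - w k) - z) + r k • ε k := by
      rw [hw k]; module
    rw [this]
    refine (norm_add_le _ _).trans_eq ?_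
    rw [norm_smul, Real.norm_of_nonneg (hr0 k)]
  have hexact : ∀ z, T z = z → ∀ k, ‖w k + r k • (T (w k) - w k) - z‖ ≤ ‖w k - z‖ := by
    intro z hz k
    refine le_of_sq_le_sq ((hT.norm_relax_sq_le hz (w k) (hr0 k)).trans ?_) (norm_nonneg _)
    linarith [mul_nonneg (hc k) (sq_nonneg ‖T (w k) - w k‖)]
  have hfejer : ∀ z, T z = z → ∀ k, ‖w (k + 1) - z‖ ≤ ‖w k - z‖ + r k * ‖ε k‖ := fun z hz k =>
    (hstep z k).trans (by linarith [hexact z hz k])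
  obtain ⟨z, hz⟩ := hfix
  set S := ∑' k, r k * ‖ε k‖
  have hpart : ∀ K, ∑ k ∈ Finset.range K, r k * ‖ε k‖ ≤ S := fun K =>
    hsum.sum_le_tsum _ fun i _ => hb i
  have hbS : ∀ k, r k * ‖ε k‖ ≤ S := fun k => hsum.le_tsum k fun i _ => hb i
  set M := ‖w 0 - z‖ + S
  have hM : ∀ k, ‖w k - z‖ ≤ M := by
    intro k
    have : ‖w k - z‖ ≤ ‖w 0 - z‖ + ∑ i ∈ Finset.range k, r i * ‖ε i‖ := by
      induction k with
      | zero => simp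
      | succ k ih => rw [Finset.sum_range_succ]; linarith [hfejer z hz k]
    linarith [hpart k]
  -- Square `hstep`: the cross term is at most `2 M` times the error, and the squared error at most
  -- `S` times the error.
  have hdec : ∀ k, ‖w (k + 1) - z‖ ^ 2 + r k * (2 - r k) * ‖T (w k) - w k‖ ^ 2
      ≤ ‖w k - z‖ ^ 2 + (2 * M + S) * (r k * ‖ε k‖) := by
    intro k
    have h1 := hstep z k
    have h2 := hT.norm_relax_sq_le hz (w k) (hr0 k)
    have h3 := (hexact z hz k).trans (hM k)
    have h4 := pow_le_pow_left₀ (norm_nonneg _) h1 2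
    nlinarith [mul_le_mul_of_nonneg_right h3 (hb k), mul_le_mul_of_nonneg_right (hbS k) (hb k)]
  have hM0 : 0 ≤ 2 * M + S := by
    have := (norm_nonneg _).trans (hM 0)
    linarith [(hb 0).trans (hbS 0)]
  have htot : ∀ K, ∑ k ∈ Finset.range K, r k * (2 - r k) * ‖T (w k) - w k‖ ^ 2
      ≤ ‖w 0 - z‖ ^ 2 + (2 * M + S) * S := by
    intro K
    have : ‖w K - z‖ ^ 2 + ∑ k ∈ Finset.range K, r k * (2 - r k) * ‖T (w k) - w k‖ ^ 2
        ≤ ‖w 0 - z‖ ^ 2 + (2 * M + S) * ∑ k ∈ Finset.range K, r k * ‖ε k‖ := by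
      induction K with
      | zero => simp
      | succ K ih =>
        rw [Finset.sum_range_succ, Finset.sum_range_succ, mul_add]
        linarith [hdec K]
    have := mul_le_mul_of_nonneg_left (hpart K) hM0
    linarith [sq_nonneg ‖w K - z‖]
  -- A residual eventually at least `δ` would make the sum in `htot` diverge with `hdiv`. Small
  -- residuals along a subsequence suffice: quasi-Fejér monotonicity recovers the full sequence.
  have hfreq : ∀ n : ℕ, ∃ᶠ k in atTop, ‖T (w k) - w k‖ < 1 / ((n : ℝ) + 1) := by
    intro n hn
    simp only [not_lt] at hn
    obtain ⟨K₀, hK₀⟩ := eventually_atTop.1 hn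
    set δ : ℝ := 1 / ((n : ℝ) + 1)
    have hδ : 0 < δ := by positivity
    have hle : ∀ K, δ ^ 2 * ∑ k ∈ Finset.range K, r k * (2 - r k)
        ≤ δ ^ 2 * ∑ k ∈ Finset.range K₀, r k * (2 - r k)
          + ∑ k ∈ Finset.range K, r k * (2 - r k) * ‖T (w k) - w k‖ ^ 2 := by
      intro K
      induction K with
      | zero =>
        simpa using mul_nonneg (sq_nonneg δ) (Finset.sum_nonneg fun i _ => hc i)
      | succ K ih =>
        rcases lt_or_ge K K₀ with hK | hK
        · have h1 : ∑ k ∈ Finset.range (K + 1), r k * (2 - r k)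
              ≤ ∑ k ∈ Finset.range K₀, r k * (2 - r k) :=
            Finset.sum_le_sum_of_subset_of_nonneg
              (Finset.range_subset_range.2 hK) fun i _ _ => hc i
          have h2 := mul_le_mul_of_nonneg_left h1 (sq_nonneg δ)
          have h3 : 0 ≤ ∑ k ∈ Finset.range (K + 1), r k * (2 - r k) * ‖T (w k) - w k‖ ^ 2 :=
            Finset.sum_nonneg fun i _ => mul_nonneg (hc i) (sq_nonneg _)
          linarith
        · have h1 := pow_le_pow_left₀ hδ.le (hK₀ K hK) 2
          have h2 := mul_le_mul_of_nonneg_left h1 (hc K)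
          rw [Finset.sum_range_succ, Finset.sum_range_succ, mul_add]
          linarith
    obtain ⟨K, hK⟩ := ((hdiv.const_mul_atTop (pow_pos hδ 2)).eventually_gt_atTop
      (δ ^ 2 * ∑ k ∈ Finset.range K₀, r k * (2 - r k)
        + (‖w 0 - z‖ ^ 2 + (2 * M + S) * S))).exists
    linarith [hle K, htot K]
  obtain ⟨φ, hφ, hφr⟩ := extraction_forall_of_frequently hfreq
  obtain ⟨x, -, ψ, hψ, hx⟩ := tendsto_subseq_of_bounded
    (Metric.isBounded_closedBall (x := z) (r := M))
    (x := w ∘ φ) fun k => by simpa [dist_eq_norm] using hM (φ k)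
  have hres : Tendsto (fun k => T (w (φ k)) - w (φ k)) atTop (𝓝 0) :=
    squeeze_zero_norm (fun k => (hφr k).le) tendsto_one_div_add_atTop_nhds_zero_nat
  have hTx : T x = x := by
    have h1 := ((hT.continuous.tendsto x).comp hx).sub hx
    exact sub_eq_zero.1 (tendsto_nhds_unique h1 (hres.comp hψ.tendsto_atTop))
  refine ⟨x, hTx, tendsto_iff_norm_sub_tendsto_zero.2 ?_⟩
  -- `hfejer` holds for every fixed point, in particular for the cluster point `x`.
  exact tendsto_zero_of_le_add_summable (fun k => norm_nonneg _) hb hsum (hfejer x hTx)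
    (hφ.comp hψ) (tendsto_iff_norm_sub_tendsto_zero.1 hx)

/-- The Douglas-Rachford iteration with summable errors. -/
theorem exists_tendsto_douglasRachford [FiniteDimensional ℝ E] {A B : E → E}
    (hA : FirmlyNonexpansive A) (hB : FirmlyNonexpansive B)
    (hfix : ∃ z, A ((2 : ℝ) • B z - z) = B z) {r : ℕ → ℝ} (hr : ∀ k, r k ∈ Ioo (0 : ℝ) 2)
    {w e : ℕ → E}
    (hw : ∀ k, w (k + 1) = w k
      + r k • (A ((2 : ℝ) • B (w k) - w k + (2 : ℝ) • e k) - B (w k) - e k))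
    (hsum : Summable fun k => r k * ‖e k‖)
    (hdiv : Tendsto (fun K => ∑ k ∈ Finset.range K, r k * (2 - r k)) atTop atTop) :
    ∃ z, A ((2 : ℝ) • B z - z) = B z ∧ Tendsto w atTop (𝓝 z) := by
  obtain ⟨z₀, hz₀⟩ := hfix
  obtain ⟨z, hz, hlim⟩ := (hA.douglasRachford hB).exists_tendsto ⟨z₀, by simp [hz₀]⟩ hr (w := w)
    (ε := fun k => A ((2 : ℝ) • B (w k) - w k + (2 : ℝ) • e k) - A ((2 : ℝ) • B (w k) - w k) - e k)
    (fun k => by rw [hw k]; module)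
    (hsum.of_nonneg_of_le (fun k => mul_nonneg (hr k).1.le (norm_nonneg _)) fun k =>
      mul_le_mul_of_nonneg_left (hA.norm_reflect_le _ _) (hr k).1.le) hdiv
  exact ⟨z, sub_eq_zero.1 (by simpa using hz), hlim⟩

end KrasnoselskiiMann

/-! ### Extended-real arithmetic. -/

theorem exists_coe_eq {a : EReal} (h : a ≠ ⊥) (h' : a ≠ ⊤) : ∃ r : ℝ, a = r :=
  ⟨_, (EReal.coe_toReal h' h).symm⟩

theorem coe_sub_le_coe_iff {a c : ℝ} {y : EReal} :
    (a : EReal) - y ≤ c ↔ ((a - c : ℝ) : EReal) ≤ y := by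
  induction y with
  | bot => simp [-EReal.coe_sub]
  | top => simp
  | coe y => norm_cast; constructor <;> intro h <;> linarith

theorem ereal_sum_ne_bot {ι : Type*} {s : Finset ι} {a : ι → EReal} (h : ∀ i ∈ s, a i ≠ ⊥) :
    ∑ i ∈ s, a i ≠ ⊥ :=
  Finset.sum_induction a (· ≠ ⊥) (fun _ _ hx hy => by simp [EReal.add_eq_bot_iff, hx, hy])
    (by simp) h

theorem ereal_sum_ne_top {ι : Type*} {s : Finset ι} {a : ι → EReal} (h : ∀ i ∈ s, a i ≠ ⊤) :
    ∑ i ∈ s, a i ≠ ⊤ :=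
  Finset.sum_induction a (· ≠ ⊤) (fun _ _ hx hy => EReal.add_ne_top hx hy) (by simp) h

theorem ereal_coe_sum {ι : Type*} (s : Finset ι) (a : ι → ℝ) :
    ((∑ i ∈ s, a i : ℝ) : EReal) = ∑ i ∈ s, (a i : EReal) :=
  map_sum (⟨⟨Real.toEReal, EReal.coe_zero⟩, EReal.coe_add⟩ : ℝ →+ EReal) a s

/-! ### Values of the Moreau envelope. -/

section Normed

variable {E : Type*} [NormedAddCommGroup E]

theorem IsProxPoint.ne_top {f : E → EReal} (hf : IsProper f) {ρ : ℝ} {w p : E}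
    (hp : IsProxPoint ρ f w p) : f p ≠ ⊤ := by
  obtain ⟨x, hx⟩ := hf.2
  intro h
  have h1 : f p + ((ρ / 2 * ‖p - w‖ ^ 2 : ℝ) : EReal) ≤ f x + ((ρ / 2 * ‖x - w‖ ^ 2 : ℝ) : EReal) :=
    isMinOn_iff.1 hp x (mem_univ x)
  rw [h, EReal.top_add_coe, top_le_iff] at h1
  exact EReal.add_ne_top hx (EReal.coe_ne_top _) h1

theorem moreauEnv_eq {f : E → EReal} {ρ : ℝ} {z p : E}
    (hp : IsProxPoint ρ f z p) {a : ℝ} (ha : f p = a) :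
    moreauEnv (1 / ρ) f z = a + ρ / 2 * ‖p - z‖ ^ 2 := by
  have e : 1 / (2 * (1 / ρ)) = ρ / 2 := by
    rw [mul_one_div, one_div_div]
  have h : (⨅ x : E, (f x + ((ρ / 2 * ‖x - z‖ ^ 2 : ℝ) : EReal)))
      = f p + ((ρ / 2 * ‖p - z‖ ^ 2 : ℝ) : EReal) :=
    le_antisymm (iInf_le (fun x => f x + ((ρ / 2 * ‖x - z‖ ^ 2 : ℝ) : EReal)) p)
      (le_iInf fun x => isMinOn_iff.1 hp x (mem_univ x))
  rw [moreauEnv, e, h, ha, ← EReal.coe_add, EReal.toReal_coe]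

theorem moreauEnv_le {f : E → EReal} {ρ : ℝ} {z' p' p : E}
    (hp' : IsProxPoint ρ f z' p') {a a' : ℝ} (ha' : f p' = a') (ha : f p = a) :
    moreauEnv (1 / ρ) f z' ≤ a + ρ / 2 * ‖p - z'‖ ^ 2 := by
  rw [moreauEnv_eq hp' ha']
  have h : f p' + ((ρ / 2 * ‖p' - z'‖ ^ 2 : ℝ) : EReal)
      ≤ f p + ((ρ / 2 * ‖p - z'‖ ^ 2 : ℝ) : EReal) := isMinOn_iff.1 hp' p (mem_univ p)
  rwa [ha, ha', ← EReal.coe_add, ← EReal.coe_add, EReal.coe_le_coe_iff] at h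

end Normed

/-! ### Proximal points, conjugates, resolvents and the gradient of the envelope. -/

section Convex

variable {E : Type*} [NormedAddCommGroup E] [InnerProductSpace ℝ E]

/-- Optimality condition of the proximal problem. -/
theorem IsProxPoint.smul_sub_mem_subdiff {f : E → EReal} (hf : IsProperConvex f) {ρ : ℝ}
    {w p : E} (hp : IsProxPoint ρ f w p) : ρ • (w - p) ∈ subdiff f p := by
  have hpt := hp.ne_top hf.1
  refine ⟨hpt, fun z => ?_⟩
  obtain ⟨a, ha⟩ := exists_coe_eq (hf.1.1 p) hpt
  by_cases hz : f z = ⊤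
  · simp [hz]
  obtain ⟨b, hb⟩ := exists_coe_eq (hf.1.1 z) hz
  rw [ha, hb, ← EReal.coe_add, EReal.coe_le_coe_iff]
  -- Compare `p` with the competitor `p + t (z - p)`, use convexity and divide by `t`; then let `t`
  -- tend to `0` from the right.
  have key : ∀ t : ℝ, 0 < t → t ≤ 1 →
      a - b ≤ ρ * ⟪p - w, z - p⟫ + ρ / 2 * t * ‖z - p‖ ^ 2 := by
    intro t ht ht1
    have hpa : (p, a) ∈ epi f := by simp [epi, ha]
    have hzb : (z, b) ∈ epi f := by simp [epi, hb]
    have h1 := hf.2 hpa hzb (sub_nonneg.2 ht1) ht.le (by ring)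
    have h2 : f ((1 - t) • p + t • z) ≤ (((1 - t) * a + t * b : ℝ) : EReal) := by
      simpa [epi] using h1
    have h3 : f p + ((ρ / 2 * ‖p - w‖ ^ 2 : ℝ) : EReal) ≤ f ((1 - t) • p + t • z)
        + ((ρ / 2 * ‖(1 - t) • p + t • z - w‖ ^ 2 : ℝ) : EReal) :=
      isMinOn_iff.1 hp _ (mem_univ _)
    have h4 := h3.trans (add_le_add_left h2 _)
    rw [ha, ← EReal.coe_add, ← EReal.coe_add, EReal.coe_le_coe_iff] at h4
    have e1 : (1 - t) • p + t • z - w = (p - w) + t • (z - p) := by module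
    rw [e1, norm_add_sq_real, inner_smul_right, norm_smul, Real.norm_of_nonneg ht.le] at h4
    have h5 : t * (a - b) ≤ t * (ρ * ⟪p - w, z - p⟫ + ρ / 2 * t * ‖z - p‖ ^ 2) := by
      linarith
    exact le_of_mul_le_mul_left h5 ht
  have hlim : Tendsto (fun t : ℝ => ρ * ⟪p - w, z - p⟫ + ρ / 2 * t * ‖z - p‖ ^ 2) (𝓝[>] 0)
      (𝓝 (ρ * ⟪p - w, z - p⟫ + ρ / 2 * 0 * ‖z - p‖ ^ 2)) :=
    (Continuous.tendsto (by fun_prop) 0).mono_left nhdsWithin_le_nhds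
  have h6 := ge_of_tendsto hlim (by
    filter_upwards [Ioc_mem_nhdsGT (zero_lt_one' ℝ)] with t ht using key t ht.1 ht.2)
  have e2 : ⟪p - w, z - p⟫ = -⟪w - p, z - p⟫ := by rw [← inner_neg_left, neg_sub]
  rw [inner_smul_left, conj_trivial]
  rw [e2] at h6
  linarith

/-- Real upper bounds of the conjugate are affine minorants of `f`; this also supplies the
coercivity needed for proximal points. -/
theorem conj_le_coe_iff {f : E → EReal} {l : E} {c : ℝ} :
    conj f l ≤ c ↔ ∀ x, ((⟪x, l⟫ - c : ℝ) : EReal) ≤ f x := by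
  simp only [conj, iSup_le_iff, coe_sub_le_coe_iff]

theorem conj_ne_bot {f : E → EReal} (hf : IsProper f) (l : E) : conj f l ≠ ⊥ := by
  obtain ⟨x, hx⟩ := hf.2
  obtain ⟨a, ha⟩ := exists_coe_eq (hf.1 x) hx
  have h : ((⟪x, l⟫ : ℝ) : EReal) - f x ≤ conj f l :=
    le_iSup (fun x : E => ((⟪x, l⟫ : ℝ) : EReal) - f x) x
  rw [ha, ← EReal.coe_sub] at h
  exact ne_bot_of_le_ne_bot (EReal.coe_ne_bot _) h

/-- A subgradient inverts to a subgradient of the conjugate. -/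
theorem mem_subdiff_conj {f : E → EReal} {x u : E} (hx : f x ≠ ⊥) (hu : u ∈ subdiff f x) :
    x ∈ subdiff (conj f) u := by
  obtain ⟨a, ha⟩ := exists_coe_eq hx hu.1
  have h1 : conj f u ≤ ((⟪x, u⟫ - a : ℝ) : EReal) := by
    refine conj_le_coe_iff.2 fun z => ?_
    refine le_trans (le_of_eq ?_) (hu.2 z)
    rw [ha, ← EReal.coe_add, inner_sub_right, real_inner_comm z u, real_inner_comm x u]
    congr 1; ring
  refine ⟨ne_top_of_le_ne_top (EReal.coe_ne_top _) h1, fun m => ?_⟩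
  refine (add_le_add_left h1 _).trans (le_trans (le_of_eq ?_)
    (le_iSup (fun x : E => ((⟪x, m⟫ : ℝ) : EReal) - f x) x))
  rw [ha, ← EReal.coe_add, ← EReal.coe_sub, inner_sub_right]
  congr 1; ring

theorem convex_epi_conj {f : E → EReal} : Convex ℝ (epi (conj f)) := by
  rintro ⟨l, c⟩ hl ⟨m, d⟩ hm s t hs ht hst
  have hl' := conj_le_coe_iff.1 (show conj f l ≤ (c : EReal) from hl)
  have hm' := conj_le_coe_iff.1 (show conj f m ≤ (d : EReal) from hm)
  change conj f (s • l + t • m) ≤ ((s * c + t * d : ℝ) : EReal)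
  refine conj_le_coe_iff.2 fun x => ?_
  have h1 := hl' x
  have h2 := hm' x
  generalize f x = y at *
  induction y with
  | bot => exact absurd (le_bot_iff.1 h1) (EReal.coe_ne_bot _)
  | top => simp
  | coe y =>
    rw [EReal.coe_le_coe_iff] at *
    rw [inner_add_right, inner_smul_right, inner_smul_right]
    have := mul_le_mul_of_nonneg_left h1 hs
    have := mul_le_mul_of_nonneg_left h2 ht
    have : y = s * y + t * y := by rw [← add_mul, hst, one_mul]
    linarith

/-- A supremum of functions continuous in `l` (constant where `f x` is infinite). It makes `H`
closed although `h` need not be. -/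
theorem lowerSemicontinuous_conj (f : E → EReal) : LowerSemicontinuous (conj f) := by
  refine lowerSemicontinuous_iSup fun x => Continuous.lowerSemicontinuous ?_
  generalize f x = y
  induction y with
  | bot => simpa using continuous_const
  | top => simpa using continuous_const
  | coe y =>
    simp only [← EReal.coe_sub]
    exact continuous_coe_real_ereal.comp (by fun_prop)

/-- Adding the two subgradient inequalities cancels the values of `f`. -/
theorem inner_sub_nonneg_of_mem_subdiff {f : E → EReal} (hf : ∀ x, f x ≠ ⊥) {x y u v : E}
    (hu : u ∈ subdiff f x) (hv : v ∈ subdiff f y) : 0 ≤ ⟪u - v, x - y⟫ := by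
  obtain ⟨a, ha⟩ := exists_coe_eq (hf x) hu.1
  obtain ⟨b, hb⟩ := exists_coe_eq (hf y) hv.1
  have h1 := hu.2 y
  have h2 := hv.2 x
  rw [ha, hb, ← EReal.coe_add, EReal.coe_le_coe_iff] at h1 h2
  simp only [inner_sub_left, inner_sub_right] at *
  linarith

/-- A map selecting points with `c (w - A w) ∈ ∂f (A w)` is firmly nonexpansive. -/
theorem firmlyNonexpansive_of_mem_subdiff {f : E → EReal} (hf : ∀ x, f x ≠ ⊥) {c : ℝ}
    (hc : 0 < c) {A : E → E} (hA : ∀ w, c • (w - A w) ∈ subdiff f (A w)) :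
    FirmlyNonexpansive A := by
  intro x y
  have h := inner_sub_nonneg_of_mem_subdiff hf (hA x) (hA y)
  rw [← smul_sub, inner_smul_left, conj_trivial] at h
  have h1 := nonneg_of_mul_nonneg_right h hc
  have e : x - A x - (y - A y) = (x - y) - (A x - A y) := by abel
  rw [e, inner_sub_left, real_inner_self_eq_norm_sq, real_inner_comm] at h1
  linarith

/-- The resolvent of a subdifferential is single-valued. -/
theorem eq_of_smul_sub_mem_subdiff {f : E → EReal} (hf : ∀ x, f x ≠ ⊥) {c : ℝ}
    (hc : 0 < c) {w p q : E} (hp : c • (w - p) ∈ subdiff f p) (hq : c • (w - q) ∈ subdiff f q) :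
    p = q := by
  have h := inner_sub_nonneg_of_mem_subdiff hf hp hq
  have e : c • (w - p) - c • (w - q) = -(c • (p - q)) := by module
  rw [e, inner_neg_left, inner_smul_left, conj_trivial, real_inner_self_eq_norm_sq] at h
  have : ‖p - q‖ ^ 2 = 0 := by
    have := sq_nonneg ‖p - q‖
    by_contra hne
    have := mul_pos hc (lt_of_le_of_ne this (Ne.symm hne))
    linarith
  exact sub_eq_zero.1 (norm_eq_zero.1 (pow_eq_zero_iff two_ne_zero |>.1 this))

/-- Existence of proximal points for a closed function with an affine minorant. -/
theorem exists_isProxPoint [FiniteDimensional ℝ E] {f : E → EReal} (hf : IsProper f)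
    (hlsc : LowerSemicontinuous f) {l : E} {c : ℝ}
    (hmin : ∀ x, ((⟪x, l⟫ - c : ℝ) : EReal) ≤ f x) {ρ : ℝ} (hρ : 0 < ρ) (w : E) :
    ∃ p, IsProxPoint ρ f w p := by
  obtain ⟨x₀, hx₀⟩ := hf.2
  obtain ⟨a, ha⟩ := exists_coe_eq (hf.1 x₀) hx₀
  set φ : E → EReal := fun u => f u + ((ρ / 2 * ‖u - w‖ ^ 2 : ℝ) : EReal) with hφ
  have hφlsc : LowerSemicontinuous φ := by
    refine hlsc.add' (Continuous.lowerSemicontinuous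
      (continuous_coe_real_ereal.comp (by fun_prop))) fun x => ?_
    exact EReal.continuousAt_add (Or.inr (EReal.coe_ne_bot _)) (Or.inr (EReal.coe_ne_top _))
  set b : ℝ := a + ρ / 2 * ‖x₀ - w‖ ^ 2 with hb
  have hφx₀ : φ x₀ = b := by simp only [hφ, ha, hb, EReal.coe_add]
  -- On the sublevel set `ρ / 2 * r ^ 2 ≤ ‖l‖ * r + |b + c - ⟪w, l⟫|` with `r = ‖u - w‖`. The
  -- summand `1` gives `r ≥ 1` outside the ball, so the constant is at most itself times `r` and one
  -- factor `r` cancels.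
  set R : ℝ := 1 + 2 / ρ * (‖l‖ + |b + c - ⟪w, l⟫|) with hR
  have hsub : φ ⁻¹' Iic (b : EReal) ⊆ Metric.closedBall w R := by
    intro u hu
    have h1 : ((⟪u, l⟫ - c + ρ / 2 * ‖u - w‖ ^ 2 : ℝ) : EReal) ≤ b := by
      rw [EReal.coe_add]
      exact (add_le_add_left (hmin u) _).trans hu
    rw [EReal.coe_le_coe_iff] at h1
    have h2 : ⟪u, l⟫ = ⟪u - w, l⟫ + ⟪w, l⟫ := by rw [← inner_add_left, sub_add_cancel]
    have h3 := (abs_le.1 (abs_real_inner_le_norm (u - w) l)).1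
    have h4 := le_abs_self (b + c - ⟪w, l⟫)
    rw [mem_closedBall_iff_norm]
    by_contra! h5
    have h6 : 0 ≤ 2 / ρ * (‖l‖ + |b + c - ⟪w, l⟫|) := by positivity
    have h7 : 1 ≤ ‖u - w‖ := by linarith
    have h8 : ‖l‖ + |b + c - ⟪w, l⟫| < ρ / 2 * ‖u - w‖ := by
      have : 2 / ρ * (‖l‖ + |b + c - ⟪w, l⟫|) < ‖u - w‖ := by linarith
      calc ‖l‖ + |b + c - ⟪w, l⟫|
          = ρ / 2 * (2 / ρ * (‖l‖ + |b + c - ⟪w, l⟫|)) := by field_simp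
        _ < _ := mul_lt_mul_of_pos_left this (by positivity)
    have h9 := mul_lt_mul_of_pos_right h8 (by linarith : 0 < ‖u - w‖)
    nlinarith [mul_le_mul_of_nonneg_left h7 (abs_nonneg (b + c - ⟪w, l⟫))]
  have hcpt : IsCompact (φ ⁻¹' Iic (b : EReal)) :=
    (isCompact_closedBall w R).of_isClosed_subset (hφlsc.isClosed_preimage _) hsub
  obtain ⟨p, hp, hpmin⟩ := LowerSemicontinuousOn.exists_isMinOn
    (⟨x₀, hφx₀.le⟩ : (φ ⁻¹' Iic (b : EReal)).Nonempty) hcpt (hφlsc.lowerSemicontinuousOn _)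
  refine ⟨p, isMinOn_iff.2 fun u _ => ?_⟩
  by_cases hu : φ u ≤ b
  · exact isMinOn_iff.1 hpmin u hu
  · exact le_trans hp (not_le.1 hu).le

/-- The gradient of the Moreau envelope. -/
theorem envGrad_eq [CompleteSpace E] {f : E → EReal} (hf : IsProperConvex f) {ρ : ℝ} (hρ : 0 < ρ)
    {P : E → E} (hP : ∀ w, IsProxPoint ρ f w (P w)) (z : E) :
    envGrad (1 / ρ) f z = ρ • (z - P z) := by
  have hfirm : FirmlyNonexpansive P := firmlyNonexpansive_of_mem_subdiff hf.1.1 hρ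
    fun w => (hP w).smul_sub_mem_subdiff hf
  have hval : ∀ w, ∃ a : ℝ, f (P w) = a := fun w =>
    exists_coe_eq (hf.1.1 _) ((hP w).ne_top hf.1)
  choose a ha using hval
  -- The proximal point of `x` is a competitor in the problem at `y`.
  have hupper : ∀ x y, moreauEnv (1 / ρ) f y - moreauEnv (1 / ρ) f x - ⟪ρ • (x - P x), y - x⟫
      ≤ ρ / 2 * ‖y - x‖ ^ 2 := by
    intro x y
    have h1 := moreauEnv_le (hP y) (ha y) (ha x)
    have h2 := moreauEnv_eq (hP x) (ha x)
    have e1 : P x - y = (P x - x) - (y - x) := by abel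
    have e2 : ⟪P x - x, y - x⟫ = -⟪x - P x, y - x⟫ := by rw [← inner_neg_left, neg_sub]
    rw [e1, norm_sub_sq_real, e2] at h1
    rw [inner_smul_left, conj_trivial, h2]
    linarith
  refine HasGradientAt.gradient (hasGradientAt_iff_isLittleO.2 ?_)
  have hO : (fun y => moreauEnv (1 / ρ) f y - moreauEnv (1 / ρ) f z - ⟪ρ • (z - P z), y - z⟫)
      =O[𝓝 z] fun y => ‖y - z‖ ^ 2 := by
    refine Asymptotics.IsBigO.of_bound (ρ / 2) (Eventually.of_forall fun y => ?_)
    rw [norm_pow, norm_norm, Real.norm_eq_abs, abs_le]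
    refine ⟨?_, hupper z y⟩
    -- The lower bound is the upper bound with the points exchanged; replacing the slope at `y` by
    -- that at `z` only helps, by `h7`.
    have h1 := hupper y z
    have h2 := hfirm y z
    have h3 := hfirm.norm_sub_le y z
    have h4 := real_inner_le_norm (P y - P z) (y - z)
    have h5 := mul_le_mul_of_nonneg_right h3 (norm_nonneg (y - z))
    have h6 : ⟪ρ • (y - P y), z - y⟫ + ⟪ρ • (z - P z), y - z⟫
        = -(ρ * (‖y - z‖ ^ 2 - ⟪P y - P z, y - z⟫)) := by
      have e1 : z - y = -(y - z) := by abel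
      rw [e1, inner_neg_right, inner_smul_left, inner_smul_left, conj_trivial,
        ← real_inner_self_eq_norm_sq]
      simp only [inner_sub_left, inner_sub_right]
      ring
    have h7 : 0 ≤ ρ * (‖y - z‖ ^ 2 - ⟪P y - P z, y - z⟫) :=
      mul_nonneg hρ.le (by linarith)
    rw [norm_sub_rev z y] at h1
    linarith
  refine hO.trans_isLittleO ?_
  have := (Asymptotics.isLittleO_norm_pow_id (E' := E) one_lt_two).comp_tendsto
    (tendsto_sub_nhds_zero_iff.2 (tendsto_id (x := 𝓝 z)))
  simpa [Function.comp_def] using this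

end Convex

section Resolvent

variable {E : Type*} [NormedAddCommGroup E] [InnerProductSpace ℝ E]

/-- The subdifferential of a closed proper convex function with at least one subgradient has
everywhere defined resolvents. -/
theorem exists_resolvent [FiniteDimensional ℝ E] {f : E → EReal} (hf : IsClosedProperConvex f)
    {l u : E} (hu : u ∈ subdiff f l) {c : ℝ} (hc : 0 < c) :
    ∃ A : E → E, ∀ w, c • (w - A w) ∈ subdiff f (A w) := by
  obtain ⟨a, ha⟩ := exists_coe_eq (hf.1.1.1 l) hu.1
  have hmin : ∀ x, ((⟪x, u⟫ - (⟪l, u⟫ - a) : ℝ) : EReal) ≤ f x := fun x => by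
    refine le_trans (le_of_eq ?_) (hu.2 x)
    rw [ha, ← EReal.coe_add, inner_sub_right, real_inner_comm x u, real_inner_comm l u]
    congr 1; ring
  choose A hA using exists_isProxPoint hf.1.1 hf.2 hmin hc
  exact ⟨A, fun w => (hA w).smul_sub_mem_subdiff hf.1⟩

/-- Fermat's rule for a sum. -/
theorem isMinOn_add_of_mem_subdiff {f g : E → EReal} (hf : ∀ x, f x ≠ ⊥) (hg : ∀ x, g x ≠ ⊥)
    {l u : E} (hu : -u ∈ subdiff f l) (hv : u ∈ subdiff g l) :
    IsMinOn (fun m => f m + g m) univ l := by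
  refine isMinOn_iff.2 fun m _ => ?_
  obtain ⟨a, ha⟩ := exists_coe_eq (hf l) hu.1
  obtain ⟨b, hb⟩ := exists_coe_eq (hg l) hv.1
  refine le_trans (le_of_eq ?_) (add_le_add (hu.2 m) (hv.2 m))
  rw [ha, hb]
  norm_cast
  rw [inner_neg_left]
  ring

/-- The set is the ball with antipodal points `∇f^γ(z)` and `∇f^γ(z) + ρ (v - z)`, so the bound is
its diameter. -/
theorem norm_sub_envGrad_le_of_mem_gradSet [CompleteSpace E] {f : E → EReal} {ρ : ℝ} (hρ : 0 < ρ)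
    {v z g : E} (hg : g ∈ gradSet (1 / ρ) f v z) :
    ‖g - envGrad (1 / ρ) f z‖ ≤ ρ * ‖v - z‖ := by
  have h1 : 1 / ρ * ‖g - envGrad (1 / ρ) f z‖ ^ 2 - ⟪g - envGrad (1 / ρ) f z, v - z⟫ ≤ 0 := hg
  have h2 := real_inner_le_norm (g - envGrad (1 / ρ) f z) (v - z)
  set a := ‖g - envGrad (1 / ρ) f z‖
  have h3 : a ^ 2 ≤ ρ * (a * ‖v - z‖) := by
    have := mul_le_mul_of_nonneg_left (sub_nonpos.1 h1 |>.trans h2) hρ.le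
    rwa [← mul_assoc, mul_one_div_cancel hρ.ne', one_mul] at this
  have ha : 0 ≤ a := norm_nonneg _
  by_contra! h4
  have h5 : 0 ≤ ρ * ‖v - z‖ := by positivity
  nlinarith

end Resolvent

/-! ### The two dual functions. -/

section DualLemmas

variable {N : ℕ} {n : Fin N → ℕ}

theorem mem_subdiff_dualH {h : Block n → EReal} {l x : Block n}
    (hx : x ∈ subdiff (conj h) (-l)) : -x ∈ subdiff (dualH h) l := by
  refine ⟨hx.1, fun z => ?_⟩
  have := hx.2 (-z)
  rwa [show -z - -l = -(z - l) by abel, inner_neg_right, ← inner_neg_left] at this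

theorem isClosedProperConvex_dualH {h : Block n → EReal} (hh : IsProper h) {l : Block n}
    (hl : dualH h l ≠ ⊤) : IsClosedProperConvex (dualH h) := by
  refine ⟨⟨⟨fun x => conj_ne_bot hh _, l, hl⟩, ?_⟩,
    (lowerSemicontinuous_conj h).comp continuous_neg⟩
  rintro ⟨x, c⟩ hx ⟨y, d⟩ hy s t hs ht hst
  have hx' : (-x, c) ∈ epi (conj h) := hx
  have hy' : (-y, d) ∈ epi (conj h) := hy
  have := convex_epi_conj hx' hy' hs ht hst
  simpa [epi, dualH, add_comm] using this

variable {f : ∀ i : Fin N, EuclideanSpace ℝ (Fin (n i)) → EReal}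

theorem dualF_ne_bot (hf : ∀ i, IsProper (f i)) (l : Block n) : dualF f l ≠ ⊥ :=
  ereal_sum_ne_bot fun i _ => conj_ne_bot (hf i) _

/-- No other summand is `⊥`, so an infinite one cannot be absorbed. Each finite conjugate value
yields an affine minorant of `f i`. -/
theorem conj_ne_top_of_dualF_ne_top (hf : ∀ i, IsProper (f i)) {l : Block n}
    (hl : dualF f l ≠ ⊤) (i : Fin N) : conj (f i) (l i) ≠ ⊤ := by
  intro hi
  refine hl ?_
  rw [dualF, ← Finset.add_sum_erase _ _ (Finset.mem_univ i), hi]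
  exact EReal.top_add_of_ne_bot (ereal_sum_ne_bot fun j _ => conj_ne_bot (hf j) _)

theorem mem_subdiff_dualF {p q : Block n} (hq : ∀ i, q i ∈ subdiff (conj (f i)) (p i)) :
    q ∈ subdiff (dualF f) p := by
  refine ⟨ereal_sum_ne_top fun i _ => (hq i).1, fun z => ?_⟩
  rw [dualF, PiLp.inner_apply, ereal_coe_sum, ← Finset.sum_add_distrib]
  exact Finset.sum_le_sum fun i _ => (hq i).2 (z i)

/-- The gradients of the envelopes of all the agents. -/
def blockGrad (ρ : ℝ) (f : ∀ i : Fin N, EuclideanSpace ℝ (Fin (n i)) → EReal) (v : Block n) :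
    Block n :=
  WithLp.toLp 2 fun i => envGrad (1 / ρ) (f i) (v i)

end DualLemmas

/-! ### The algorithm as a perturbed Douglas-Rachford iteration. -/

namespace Trajectory

variable {N : ℕ} {n : Fin N → ℕ} {h : Block n → EReal}
  {f : ∀ i : Fin N, EuclideanSpace ℝ (Fin (n i)) → EReal} {ρ : ℝ} {η : ℕ → ℝ} {t : Trajectory n}

theorem IsGenerated.lam_succ (ht : t.IsGenerated ρ η h f) (hρ : 0 < ρ) (k : ℕ) :
    t.lam (k + 1) = ρ • t.v ρ η k - ρ • t.y (k + 1) := by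
  rw [ht.lam_update k, v, smul_add, smul_smul, mul_one_div_cancel hρ.ne']
  module

/-- `ρ (v - y)` is the estimate `g` when the guess is kept and, by the envelope formula, the exact
gradient after communication; `err` is the discrepancy in both cases. -/
theorem IsGenerated.lam_succ_eq (ht : t.IsGenerated ρ η h f) (hρ : 0 < ρ)
    (hf : ∀ i, IsProperConvex (f i))
    {P : ∀ i, EuclideanSpace ℝ (Fin (n i)) → EuclideanSpace ℝ (Fin (n i))}
    (hP : ∀ i w, IsProxPoint ρ (f i) w (P i w)) (k : ℕ) :
    t.lam (k + 1) = blockGrad ρ f (t.v ρ η k) + t.err ρ η f k := by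
  rw [ht.lam_succ hρ]
  by_cases hc : t.Communicates ρ η k
  · rw [err, if_pos hc, add_zero]
    ext1 i
    have : t.y (k + 1) i = P i (t.v ρ η k i) :=
      eq_of_smul_sub_mem_subdiff (hf i).1.1 hρ
        ((ht.y_communicated k hc i).smul_sub_mem_subdiff (hf i))
        ((hP i _).smul_sub_mem_subdiff (hf i))
    change _ = envGrad (1 / ρ) (f i) (t.v ρ η k i)
    rw [envGrad_eq (hf i) hρ (hP i), ← this, PiLp.sub_apply, PiLp.smul_apply,
      PiLp.smul_apply, smul_sub]
  · rw [err, if_neg hc, ht.y_guessed k hc, yGuess, smul_sub, smul_smul,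
      mul_one_div_cancel hρ.ne', blockGrad]
    module

/-- In terms of `ρ v^k` the algorithm is a perturbed Douglas-Rachford iteration. -/
theorem IsGenerated.v_succ (ht : t.IsGenerated ρ η h f) (hρ : 0 < ρ) (hh : IsProperConvex h)
    {A : Block n → Block n} (hA : ∀ w, (1 / ρ) • (w - A w) ∈ subdiff (dualH h) (A w)) (k : ℕ) :
    ρ • t.v ρ η (k + 1) = ρ • t.v ρ η k
      + η (k + 1) • (A ((2 : ℝ) • t.lam (k + 1) - ρ • t.v ρ η k) - t.lam (k + 1)) := by
  have hx := ht.x_update (k + 1)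
  have h1 := mem_subdiff_dualH (l := -(ρ • (t.y (k + 1) - (1 / ρ) • t.lam (k + 1) - t.x (k + 2))))
    (by rw [neg_neg]; exact mem_subdiff_conj (hh.1.1 _) (hx.smul_sub_mem_subdiff hh))
  -- Optimality of `x^{k+2}` says `-μ ∈ ∂h(x^{k+2})`, hence `-x^{k+2} ∈ ∂H(μ)`: this makes `μ` the
  -- value of the resolvent `A`.
  set μ := -(ρ • (t.y (k + 1) - (1 / ρ) • t.lam (k + 1) - t.x (k + 2))) with hμ
  have hyl : ρ • t.y (k + 1) = ρ • t.v ρ η k - t.lam (k + 1) := by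
    rw [ht.lam_succ hρ k]; abel
  have hμ' : μ = ρ • t.x (k + 2) - ρ • t.y (k + 1) + t.lam (k + 1) := by
    rw [hμ, smul_sub, smul_sub, smul_smul, mul_one_div_cancel hρ.ne']; module
  have hAμ : A ((2 : ℝ) • t.lam (k + 1) - ρ • t.v ρ η k) = μ := by
    refine eq_of_smul_sub_mem_subdiff (fun x => conj_ne_bot hh.1 _) (one_div_pos.2 hρ) (hA _) ?_
    have e : (2 : ℝ) • t.lam (k + 1) - ρ • t.v ρ η k - μ = ρ • -t.x (k + 2) := by
      rw [hμ', hyl]; module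
    rwa [e, smul_smul, one_div_mul_cancel hρ.ne', one_smul]
  rw [hAμ, hμ', v, xt, smul_add, smul_smul ρ (1 / ρ), mul_one_div_cancel hρ.ne', smul_add,
    smul_comm ρ (η (k + 1)), smul_comm ρ (1 - η (k + 1)), hyl]
  module

/-- After a communication round `j` the error is controlled by the distance to `v^j`. -/
theorem IsGenerated.norm_err_le (ht : t.IsGenerated ρ η h f) (hρ : 0 < ρ)
    (hf : ∀ i, IsProperConvex (f i))
    {P : ∀ i, EuclideanSpace ℝ (Fin (n i)) → EuclideanSpace ℝ (Fin (n i))}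
    (hP : ∀ i w, IsProxPoint ρ (f i) w (P i w)) {j k : ℕ} (hjk : j < k)
    (hj : t.Communicates ρ η j) :
    ‖t.err ρ η f k‖ ≤ 3 * ρ * ‖t.v ρ η k - t.v ρ η j‖ := by
  have h0 : 0 ≤ 3 * ρ * ‖t.v ρ η k - t.v ρ η j‖ := by positivity
  by_cases hc : t.Communicates ρ η k
  · rwa [err, if_pos hc, norm_zero]
  have hmem : j ∈ t.queries ρ η k := ⟨hjk, hj⟩
  refine le_of_sq_le_sq ?_ h0
  rw [mul_pow, PiLp.norm_sq_eq_of_L2, PiLp.norm_sq_eq_of_L2, Finset.mul_sum]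
  refine Finset.sum_le_sum fun i _ => ?_
  rw [← mul_pow, PiLp.sub_apply]
  refine pow_le_pow_left₀ (norm_nonneg _) ?_ 2
  obtain ⟨-, -, -, hg, -⟩ := ht.estimate k ⟨j, hmem⟩ i
  have h1 := norm_sub_envGrad_le_of_mem_gradSet hρ (hg j hmem)
  have hfirm : FirmlyNonexpansive (P i) := firmlyNonexpansive_of_mem_subdiff (hf i).1.1 hρ
    fun w => (hP i w).smul_sub_mem_subdiff (hf i)
  have h2 := hfirm.norm_sub_le (t.v ρ η k i) (t.v ρ η j i)
  rw [err, if_neg hc, PiLp.sub_apply]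
  simp only [envGrad_eq (hf i) hρ (hP i)] at h1 ⊢
  set a := t.v ρ η k i
  set b := t.v ρ η j i
  -- The constant `3 ρ`: one `ρ` from the diameter of the ball at `v^j`, and `2 ρ` from the triangle
  -- inequality for the gradients at `v^k` and `v^j`.
  have e : t.g k i - ρ • (a - P i a)
      = (t.g k i - ρ • (b - P i b)) - ρ • ((a - b) - (P i a - P i b)) := by module
  rw [e]
  refine (norm_sub_le _ _).trans ?_
  rw [norm_smul, Real.norm_of_nonneg hρ.le]
  have h3 := mul_le_mul_of_nonneg_left ((norm_sub_le (a - b) (P i a - P i b)).trans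
    (add_le_add_right h2 _)) hρ.le
  linarith

end Trajectory

end ProxEstimation

end

/-! ### Proof of the theorem. -/

theorem mainTheorem6 {N : ℕ} (n : Fin N → ℕ)
    (h : ProxEstimation.Block n → EReal)
    (f : ∀ i : Fin N, EuclideanSpace ℝ (Fin (n i)) → EReal)
    (hh : ProxEstimation.IsProperConvex h)
    (hf : ∀ i, ProxEstimation.IsClosedProperConvex (f i))
    (hsol : ∃ l u : ProxEstimation.Block n,
      -u ∈ ProxEstimation.subdiff (ProxEstimation.dualH h) l ∧
      u ∈ ProxEstimation.subdiff (ProxEstimation.dualF f) l)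
    (ρ : ℝ) (hρ : 0 < ρ)
    (η : ℕ → ℝ) (hη : ∀ k, η k ∈ Set.Ioo (0 : ℝ) 2)
    (t : ProxEstimation.Trajectory n)
    (ht : t.IsGenerated ρ η h f)
    (herr : Summable (fun k => η (k + 1) * ‖t.err ρ η f k‖))
    (hdiv : Tendsto (fun K => ∑ k ∈ Finset.range K, η k * (2 - η k)) atTop atTop) :
    ∃ l : ProxEstimation.Block n, ProxEstimation.IsDualOptimizer h f l ∧
      Tendsto (fun k => t.lam (k + 1) - t.err ρ η f k) atTop (𝓝 l) ∧
      (Tendsto t.lam atTop (𝓝 l) ↔ Tendsto (t.err ρ η f) atTop (𝓝 0)) ∧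
      ({k | t.Communicates ρ η k}.Infinite → Tendsto t.lam atTop (𝓝 l)) := by
  open ProxEstimation in
  obtain ⟨l₀, u₀, hH₀, hF₀⟩ := hsol
  have hρ' : 0 < 1 / ρ := one_div_pos.2 hρ
  have hfp : ∀ i, IsProper (f i) := fun i => (hf i).1.1
  have hprox : ∀ i w, ∃ p, IsProxPoint ρ (f i) w p := by
    intro i
    obtain ⟨c, hc⟩ := exists_coe_eq (conj_ne_bot (hfp i) _)
      (conj_ne_top_of_dualF_ne_top hfp hF₀.1 i)
    exact exists_isProxPoint (hfp i) (hf i).2 (conj_le_coe_iff.1 hc.le) hρ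
  choose P hP using hprox
  have hHbot : ∀ x, dualH h x ≠ ⊥ := fun x => conj_ne_bot hh.1 _
  have hFbot := dualF_ne_bot hfp
  obtain ⟨A, hA⟩ := exists_resolvent (isClosedProperConvex_dualH hh.1 hH₀.1) hH₀ hρ'
  set B : Block n → Block n := fun w => blockGrad ρ f ((1 / ρ) • w) with hBdef
  have hB : ∀ w, (1 / ρ) • (w - B w) ∈ subdiff (dualF f) (B w) := by
    refine fun w => mem_subdiff_dualF fun i => ?_
    have e1 : B w i = ρ • ((1 / ρ) • w i - P i ((1 / ρ) • w i)) := by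
      rw [hBdef]
      exact envGrad_eq (hf i).1 hρ (hP i) _
    have e2 : ((1 / ρ) • (w - B w)) i = P i ((1 / ρ) • w i) := by
      rw [PiLp.smul_apply, PiLp.sub_apply, e1, smul_sub ρ, smul_smul, mul_one_div_cancel hρ.ne',
        one_smul, sub_sub_cancel, smul_smul, one_div_mul_cancel hρ.ne', one_smul]
    rw [e1, e2]
    exact mem_subdiff_conj ((hfp i).1 _) ((hP i _).smul_sub_mem_subdiff (hf i).1)
  have hAf := firmlyNonexpansive_of_mem_subdiff hHbot hρ' hA
  have hBf := firmlyNonexpansive_of_mem_subdiff hFbot hρ' hB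
  have hfix : ∃ z, A ((2 : ℝ) • B z - z) = B z := by
    -- A dual solution `l₀` with `u₀ ∈ ∂F(l₀)` and `-u₀ ∈ ∂H(l₀)` corresponds to the fixed point `l₀
    -- + ρ u₀`.
    have hb : B (l₀ + ρ • u₀) = l₀ := eq_of_smul_sub_mem_subdiff hFbot hρ' (hB _) (by
      rwa [add_sub_cancel_left, smul_smul, one_div_mul_cancel hρ.ne', one_smul])
    refine ⟨l₀ + ρ • u₀, ?_⟩
    rw [hb]
    refine eq_of_smul_sub_mem_subdiff hHbot hρ' (hA _) ?_
    have e : (2 : ℝ) • l₀ - (l₀ + ρ • u₀) - l₀ = ρ • -u₀ := by module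
    rwa [e, smul_smul, one_div_mul_cancel hρ.ne', one_smul]
  have hlam : ∀ k, t.lam (k + 1) = B (ρ • t.v ρ η k) + t.err ρ η f k := fun k => by
    rw [ht.lam_succ_eq hρ (fun i => (hf i).1) hP k, hBdef]
    simp only [smul_smul, one_div_mul_cancel hρ.ne', one_smul]
  -- The step from `v^k` to `v^{k+1}` uses `η^{k+1}`, so the divergent series loses its first term.
  have hdiv' : Tendsto (fun K => ∑ k ∈ Finset.range K, η (k + 1) * (2 - η (k + 1))) atTop atTop := by
    have := (hdiv.comp (tendsto_add_atTop_nat 1)).atTop_add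
      (tendsto_const_nhds (x := -(η 0 * (2 - η 0))))
    refine this.congr fun K => ?_
    simp [Finset.sum_range_succ']
  obtain ⟨z, hz, hlim⟩ := exists_tendsto_douglasRachford hAf hBf hfix (fun k => hη (k + 1))
    (w := fun k => ρ • t.v ρ η k) (e := t.err ρ η f) (fun k => by
      rw [ht.v_succ hρ hh hA k, hlam k]
      congr 2
      rw [sub_sub]
      congr 2
      module) herr hdiv'
  have hmain : Tendsto (fun k => t.lam (k + 1) - t.err ρ η f k) atTop (𝓝 (B z)) :=
    ((hBf.continuous.tendsto z).comp hlim).congr fun k => by simp [hlam k]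
  have hiff : Tendsto t.lam atTop (𝓝 (B z)) ↔ Tendsto (t.err ρ η f) atTop (𝓝 0) := by
    rw [← tendsto_add_atTop_iff_nat 1]
    constructor
    · intro h1
      simpa using h1.sub hmain
    · intro h1
      simpa using hmain.add h1
  refine ⟨B z, ?_, hmain, hiff, fun hinf => hiff.2 ?_⟩
  -- Conversely, a fixed point `z` yields the common subgradient `(z - B z) / ρ`.
  · refine isMinOn_add_of_mem_subdiff hHbot hFbot (u := (1 / ρ) • (z - B z)) ?_ (hB z)
    have h1 := hA ((2 : ℝ) • B z - z)
    rw [hz] at h1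
    have e : (1 / ρ) • ((2 : ℝ) • B z - z - B z) = -((1 / ρ) • (z - B z)) := by module
    rwa [e] at h1
  · have hv : CauchySeq (t.v ρ η) := by
      refine Tendsto.cauchySeq (x := (1 / ρ) • z) ((hlim.const_smul (1 / ρ)).congr fun k => ?_)
      rw [smul_smul, one_div_mul_cancel hρ.ne', one_smul]
    rw [Metric.tendsto_atTop]
    intro ε hε
    obtain ⟨K, hK⟩ := Metric.cauchySeq_iff.1 hv (ε / (3 * ρ)) (by positivity)
    -- One communication round `j` in the Cauchy tail controls all later errors.
    obtain ⟨j, hj, hKj⟩ := hinf.exists_gt K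
    refine ⟨j + 1, fun k hk => ?_⟩
    have h1 := hK k (by omega) j hKj.le
    rw [dist_eq_norm, lt_div_iff₀' (by positivity)] at h1
    rw [dist_zero_right]
    exact (ht.norm_err_le hρ (fun i => (hf i).1) hP hk hj).trans_lt h1
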